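/- Let $X_1,X_2,\dots$ be i.i.d. real random variables with Lebesgue density $f$ and distribution function $F(x)=\int_{-\infty}^x f(t)\,dt$, and let $F_n$ be the empirical distribution function of $X_1,\dots,X_n$. Let $K:\mathbb{R}\to\mathbb{R}$ be a kernel of order $\ell\in\mathbb{N}$, $\ell\ge 1$; that is, $u^jK(u)\in L_1(\mathbb{R})$ for $0\le j\le \ell$, $\int K(u)\,du=1$, $\int u^jK(u)\,du=0$ for $1\le j\le \ell-1$, and $\int u^\ell K(u)\,du\neq 0$. For $h>0$ put $$\hat f_h(x)=\frac1{nh}\sum_{i=1}^nK\Big(\frac{x-X_i}{h}\Big),\qquad \hat F_n^h(x)=\int_{-\infty}^x\hat f_h(t)\,dt .$$ Let $d$ be either the Kolmogorov distance $d_\infty(G,H)=\sup_{x}|G(x)-H(x)|$ or, for some integer $k\ge1$, the $k$-th order Kuiper distance $$d_{kuip,k}(G,H)=\sup_{a_1\le b_1\le a_2\le b_2\le\dots\le a_k\le b_k}\ \sum_{i=1}^k\big|(G(b_i)-G(a_i))-(H(b_i)-H(a_i))\big| .$$ Suppose that $F$ is Hölder continuous with exponent $\alpha$ for some $0<\alpha\le1$,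 i.e. there is a constant $C$ with $|F(x)-F(y)|\le C|x-y|^\alpha$ for all $x,y\in\mathbb{R}$. Let $s:\mathbb{N}\to\mathbb{R}$ be a threshold function such that, as $n\to\infty$, $$\sqrt{\frac{\log\log n}{n}}=o(s(n))\qquad\text{and}\qquad n^\alpha s(n)\to\infty .$$ Then, with probability $1$, every sequence $(h_{s,n})_n$ of discrepancy-principle bandwidths, i.e. every sequence of reals such that for all sufficiently large $n$ $$h_{s,n}>0\quad\text{and}\quad d\big(F_n,\hat F_n^{h_{s,n}}\big)=s(n),$$ satisfies $n\,h_{s,n}\to\infty$. -/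

import Mathlib

open MeasureTheory ProbabilityTheory Filter Topology Asymptotics
open scoped NNReal ENNReal

namespace DiscrepancyPrinciple

/-- `K` is a kernel of order `ℓ`: the functions `u ^ j * K u`, `j ≤ ℓ`, are Lebesgue integrable,
`K` has integral one, its moments of orders `1, …, ℓ - 1` vanish, and its `ℓ`-th moment does not. -/
structure IsKernelOfOrder (K : ℝ → ℝ) (ℓ : ℕ) : Prop where
  integrable : ∀ j ≤ ℓ, Integrable (fun u : ℝ => u ^ j * K u)
  integral_eq_one : ∫ u : ℝ, K u = 1
  moment_eq_zero : ∀ j, 1 ≤ j → j < ℓ → ∫ u : ℝ, u ^ j * K u = 0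
  moment_ne_zero : ∫ u : ℝ, u ^ ℓ * K u ≠ 0

/-- `f` is a probability density with respect to Lebesgue measure on `ℝ`. -/
structure IsProbDensity (f : ℝ → ℝ) : Prop where
  nonneg : ∀ x, 0 ≤ f x
  integrable : Integrable f
  integral_eq_one : ∫ x : ℝ, f x = 1

/-- The function `x ↦ ∫_{-∞}^x f(t) dt`. -/
noncomputable def distFun (f : ℝ → ℝ) (x : ℝ) : ℝ :=
  ∫ t in Set.Iic x, f t

/-- The empirical distribution function of the first `n` members `x 0, …, x (n - 1)` of a sample. -/
noncomputable def empDistFun (x : ℕ → ℝ) (n : ℕ) (t : ℝ) : ℝ :=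
  (∑ i ∈ Finset.range n, if x i ≤ t then (1 : ℝ) else 0) / n

/-- The kernel density estimator with bandwidth `h` built from `x 0, …, x (n - 1)`. -/
noncomputable def kernelDensityEst (K : ℝ → ℝ) (x : ℕ → ℝ) (n : ℕ) (h : ℝ) (t : ℝ) : ℝ :=
  1 / (n * h) * ∑ i ∈ Finset.range n, K ((t - x i) / h)

/-- The kernel estimator of the distribution function: the integral over `(-∞, y]` of the kernel
density estimator. -/
noncomputable def kernelDistFunEst (K : ℝ → ℝ) (x : ℕ → ℝ) (n : ℕ) (h : ℝ) : ℝ → ℝ :=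
  distFun (kernelDensityEst K x n h)

/-- The Kolmogorov distance `sup_x |F x - G x|` (of bounded functions). -/
noncomputable def kolmogorovDist (F G : ℝ → ℝ) : ℝ :=
  ⨆ x : ℝ, |F x - G x|

/-- The pairs of `k`-tuples with `a₁ ≤ b₁ ≤ a₂ ≤ b₂ ≤ ⋯ ≤ a_k ≤ b_k`. -/
def intervalTuples (k : ℕ) : Set ((Fin k → ℝ) × (Fin k → ℝ)) :=
  {p | (∀ i, p.1 i ≤ p.2 i) ∧ ∀ i j, i < j → p.2 i ≤ p.1 j}

/-- The Kuiper distance of order `k` (of bounded functions). -/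
noncomputable def kuiperDist (k : ℕ) (F G : ℝ → ℝ) : ℝ :=
  ⨆ p : intervalTuples k,
    ∑ i, |(F (p.1.2 i) - F (p.1.1 i)) - (G (p.1.2 i) - G (p.1.1 i))|

/-- `h` is a bandwidth chosen by the discrepancy principle with distance `d` and threshold `s`, for
the sample `x 0, …, x (n - 1)`. -/
def IsDiscrepancyBandwidth (d : (ℝ → ℝ) → (ℝ → ℝ) → ℝ) (s : ℕ → ℝ) (K : ℝ → ℝ) (x : ℕ → ℝ)
    (n : ℕ) (h : ℝ) : Prop :=
  0 < h ∧ d (empDistFun x n) (kernelDistFunEst K x n h) = s n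

end DiscrepancyPrinciple

namespace DiscrepancyPrinciple

/-! ### Mass of intervals under the density -/

section Density

variable {f : ℝ → ℝ}

/-! Smoothing averages translates of the empirical distribution function against `K`, so a small
bandwidth can only produce a small discrepancy. If increments of `F_n` over length `r` are at most
`A * r ^ α + ε n`, then `kernelDistFunEst` differs from `F_n` uniformly by `O(h ^ α + ε n)`, and so
does every admissible `d` (`abs_empDistFun_sub_kernelDistFunEst_le`, `exists_dist_le_mul`). When `ε
n = o(s n)`, the equation `d = s n` forces `s n ≤ c * h ^ α`, hence `n ^ α * s n ≤ c * (n * h) ^ α`,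
and the left side diverges.

The modulus comes from `ae_eventually_empDistFun_sub_le`: a Chernoff bound, a union bound over a
grid and Borel–Cantelli give empirical increments of at most twice the true ones plus `O(log n /
n)`. The factor 2 is harmless, and it buys an error below `√(log log n / n)`. The exceptional null
set does not involve `h`, so all bandwidth sequences are treated at once. -/

theorem IsProbDensity.measureReal_withDensity (hf : IsProbDensity f) {S : Set ℝ}
    (hS : MeasurableSet S) :
    (volume.withDensity fun x => ENNReal.ofReal (f x)).real S = ∫ x in S, f x := by
  rw [measureReal_def, withDensity_apply _ hS,
    ← ofReal_integral_eq_lintegral_ofReal hf.integrable.integrableOn (ae_of_all _ hf.nonneg),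
    ENNReal.toReal_ofReal (integral_nonneg hf.nonneg)]

theorem IsProbDensity.isProbabilityMeasure_withDensity (hf : IsProbDensity f) :
    IsProbabilityMeasure (volume.withDensity fun x => ENNReal.ofReal (f x)) := by
  constructor
  rw [withDensity_apply _ MeasurableSet.univ, Measure.restrict_univ,
    ← ofReal_integral_eq_lintegral_ofReal hf.integrable (ae_of_all _ hf.nonneg),
    hf.integral_eq_one, ENNReal.ofReal_one]

theorem IsProbDensity.measureReal_Icc (hf : IsProbDensity f) {a b : ℝ} (hab : a ≤ b) :
    (volume.withDensity fun x => ENNReal.ofReal (f x)).real (Set.Icc a b) =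
      distFun f b - distFun f a := by
  rw [hf.measureReal_withDensity measurableSet_Icc, integral_Icc_eq_integral_Ioc,
    ← intervalIntegral.integral_of_le hab, distFun, distFun,
    intervalIntegral.integral_Iic_sub_Iic hf.integrable.integrableOn hf.integrable.integrableOn]

theorem IsProbDensity.monotone_distFun (hf : IsProbDensity f) : Monotone (distFun f) := by
  intro a b hab
  have h := hf.measureReal_Icc hab
  have := measureReal_nonneg (μ := volume.withDensity fun x => ENNReal.ofReal (f x))
    (s := Set.Icc a b)
  linarith

theorem IsProbDensity.distFun_nonneg (hf : IsProbDensity f) (x : ℝ) : 0 ≤ distFun f x :=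
  integral_nonneg hf.nonneg

theorem IsProbDensity.distFun_le_one (hf : IsProbDensity f) (x : ℝ) : distFun f x ≤ 1 := by
  rw [← hf.integral_eq_one]
  exact setIntegral_le_integral hf.integrable (ae_of_all _ hf.nonneg)

theorem IsProbDensity.measurableSet_distFun_preimage (hf : IsProbDensity f) (c d : ℝ) :
    MeasurableSet (distFun f ⁻¹' Set.Ico c d) :=
  hf.monotone_distFun.measurable measurableSet_Ico

/-- The distribution function transform spreads no more mass on an interval than the uniform
distribution does. -/
theorem IsProbDensity.measureReal_distFun_preimage_le (hf : IsProbDensity f) {c d : ℝ}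
    (hcd : c ≤ d) :
    (volume.withDensity fun x => ENNReal.ofReal (f x)).real (distFun f ⁻¹' Set.Ico c d) ≤
      d - c := by
  have := hf.isProbabilityMeasure_withDensity
  set μ := volume.withDensity fun x => ENNReal.ofReal (f x) with hμ
  refine ENNReal.toReal_le_of_le_ofReal (sub_nonneg.2 hcd) ?_
  -- Inner regularity replaces quantiles: a compact subset lies between its extreme points `a` and
  -- `b`, which belong to the preimage, so its mass is at most `F b - F a ≤ d - c`.
  rw [(hf.measurableSet_distFun_preimage c d).measure_eq_iSup_isCompact_of_ne_top
    (measure_ne_top _ _)]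
  refine iSup_le fun S => iSup_le fun hS => iSup_le fun hSc => ?_
  rcases S.eq_empty_or_nonempty with rfl | hne
  · simp
  obtain ⟨a, ha, ha'⟩ := hSc.exists_isLeast hne
  obtain ⟨b, hb, hb'⟩ := hSc.exists_isGreatest hne
  have hsub : S ⊆ Set.Icc a b := fun x hx => ⟨ha' hx, hb' hx⟩
  have h := hf.measureReal_Icc (ha' hb)
  calc μ S ≤ μ (Set.Icc a b) := measure_mono hsub
    _ = ENNReal.ofReal (distFun f b - distFun f a) := by
      rw [← h, ofReal_measureReal]
    _ ≤ ENNReal.ofReal (d - c) := by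
      have h1 := (hS ha).1
      have h2 := (hS hb).2
      exact ENNReal.ofReal_le_ofReal (by linarith)

end Density

/-! ### Uniform control of empirical increments -/

section Counting

variable {Ω : Type*} [MeasurableSpace Ω] {P : Measure Ω} [IsProbabilityMeasure P]
  {X : ℕ → Ω → ℝ}

/-- A multiplicative Chernoff bound for the number of sample points in a set. -/
theorem measureReal_le_sum_indicator_le (hX : ∀ i, AEMeasurable (X i) P) (hindep : iIndepFun X P)
    {B : Set ℝ} (hB : MeasurableSet B) {p : ℝ} (hp : ∀ i, P.real (X i ⁻¹' B) ≤ p) (n : ℕ) (t : ℝ) :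
    P.real {ω | 2 * (n * p) + t ≤ ∑ i ∈ Finset.range n, B.indicator (fun _ => (1 : ℝ)) (X i ω)} ≤
      Real.exp (-t) := by
  set g : ℝ → ℝ := B.indicator fun _ => 1 with hg
  have hgm : Measurable g := measurable_const.indicator hB
  have hYm : ∀ i, AEMeasurable (fun ω => g (X i ω)) P := fun i => hgm.comp_aemeasurable (hX i)
  have hYi : iIndepFun (fun i ω => g (X i ω)) P := hindep.comp (fun _ => g) fun _ => hgm
  have hg1 : ∀ x, g x ≤ 1 := Set.indicator_le_self' fun _ _ => zero_le_one
  have hp0 : 0 ≤ p := measureReal_nonneg.trans (hp 0)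
  have hmgf : ∀ i, mgf (fun ω => g (X i ω)) P 1 ≤ Real.exp (2 * p) := by
    intro i
    -- On values 0 and 1 the exponential is affine. Since `e - 1 < 2`, the mgf at 1 is at most `1 +
    -- 2 * p ≤ exp (2 * p)`, the source of the factor 2.
    have hexp : ∀ ω, Real.exp (1 * g (X i ω)) = 1 + (Real.exp 1 - 1) * g (X i ω) := by
      intro ω
      by_cases h : X i ω ∈ B <;> simp [hg, h]
    have hint : Integrable (fun ω => g (X i ω)) P := by
      refine Integrable.of_bound (hYm i).aestronglyMeasurable 1 (ae_of_all _ fun ω => ?_)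
      by_cases h : X i ω ∈ B <;> simp [hg, h]
    have hval : ∫ ω, g (X i ω) ∂P = P.real (X i ⁻¹' B) := by
      rw [← integral_map (hX i) hgm.aestronglyMeasurable, hg, integral_indicator_const _ hB,
        map_measureReal_apply_of_aemeasurable (hX i) hB, smul_eq_mul, mul_one]
    rw [mgf]
    simp_rw [hexp]
    rw [integral_add (integrable_const _) (hint.const_mul _), integral_const_mul, hval]
    have he : Real.exp 1 < 3 := Real.exp_one_lt_three
    have h0 : 0 ≤ P.real (X i ⁻¹' B) := measureReal_nonneg
    have h1 := hp i
    have h2 := Real.add_one_le_exp (2 * p)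
    simp only [integral_const, probReal_univ, smul_eq_mul, mul_one]
    nlinarith
  have hsum : (fun ω => ∑ i ∈ Finset.range n, g (X i ω)) =
      ∑ i ∈ Finset.range n, fun ω => g (X i ω) := by
    ext ω; simp
  have hint : Integrable
      (fun ω => Real.exp (1 * (∑ i ∈ Finset.range n, fun ω => g (X i ω)) ω)) P := by
    refine Integrable.of_bound (C := Real.exp n) ?_ (ae_of_all _ fun ω => ?_)
    · rw [← hsum]
      exact (Real.measurable_exp.comp_aemeasurable
        ((Finset.aemeasurable_fun_sum _ fun i _ => hYm i).const_mul 1)).aestronglyMeasurable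
    · rw [Real.norm_eq_abs, Real.abs_exp, Finset.sum_apply, one_mul, Real.exp_le_exp]
      calc ∑ i ∈ Finset.range n, g (X i ω) ≤ ∑ i ∈ Finset.range n, (1 : ℝ) :=
            Finset.sum_le_sum fun i _ => hg1 _
        _ = n := by simp
  have h := measure_ge_le_exp_mul_mgf (μ := P) (2 * (n * p) + t) zero_le_one hint
  rw [hYi.mgf_sum₀ hYm, ← hsum] at h
  refine h.trans ?_
  calc Real.exp (-1 * (2 * (n * p) + t)) * ∏ i ∈ Finset.range n, mgf (fun ω => g (X i ω)) P 1
      ≤ Real.exp (-1 * (2 * (n * p) + t)) * ∏ i ∈ Finset.range n, Real.exp (2 * p) := by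
        gcongr with i _
        · exact fun i _ => mgf_nonneg
        · exact hmgf i
    _ = Real.exp (-t) := by
        rw [Finset.prod_const, Finset.card_range, ← Real.exp_nat_mul, ← Real.exp_add]
        ring_nf

variable {f : ℝ → ℝ}

/-- Almost surely, eventually, every interval with endpoints in the grid of mesh `1 / n` contains at
most `4 log n` of the transformed sample points more than twice the expected number. -/
theorem ae_eventually_sum_indicator_le (hf : IsProbDensity f)
    (hX : ∀ i, HasLaw (X i) (volume.withDensity fun x => ENNReal.ofReal (f x)) P)
    (hindep : iIndepFun X P) :
    ∀ᵐ ω ∂P, ∀ᶠ n : ℕ in atTop, ∀ i ≤ n + 1, ∀ m ≤ n + 1, i ≤ m →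
      ∑ j ∈ Finset.range n, (distFun f ⁻¹' Set.Ico ((i : ℝ) / n) ((m : ℝ) / n)).indicator
        (fun _ => (1 : ℝ)) (X j ω) ≤ 2 * ((m : ℝ) - i) + 4 * Real.log n := by
  -- The excess `4 * log n` gives each bad event probability at most `n⁻⁴`; at most `9 * n ^ 2`
  -- pairs then leave a summable `9 * n⁻²`.
  let E : ℕ → ℕ × ℕ → Set Ω := fun n q => {ω | 2 * ((q.2 : ℝ) - q.1) + 4 * Real.log n ≤
    ∑ j ∈ Finset.range n, (distFun f ⁻¹' Set.Ico ((q.1 : ℝ) / n) ((q.2 : ℝ) / n)).indicator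
      (fun _ => (1 : ℝ)) (X j ω)}
  let T : ℕ → Finset (ℕ × ℕ) := fun n =>
    (Finset.range (n + 2) ×ˢ Finset.range (n + 2)).filter fun q => q.1 ≤ q.2
  have hE : ∀ n, 1 ≤ n → ∀ q ∈ T n, P.real (E n q) ≤ ((n : ℝ) ^ 4)⁻¹ := by
    intro n hn q hq
    have hn0 : (0 : ℝ) < n := by exact_mod_cast hn
    have hq' : (q.1 : ℝ) ≤ q.2 := by exact_mod_cast (Finset.mem_filter.1 hq).2
    have hB := hf.measurableSet_distFun_preimage ((q.1 : ℝ) / n) ((q.2 : ℝ) / n)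
    have h := measureReal_le_sum_indicator_le (fun i => (hX i).aemeasurable) hindep hB
      (p := (q.2 : ℝ) / n - (q.1 : ℝ) / n)
      (fun i => by
        rw [← map_measureReal_apply_of_aemeasurable (hX i).aemeasurable hB, (hX i).map_eq]
        exact hf.measureReal_distFun_preimage_le (by gcongr)) n (4 * Real.log n)
    have h1 : (n : ℝ) * ((q.2 : ℝ) / n - (q.1 : ℝ) / n) = (q.2 : ℝ) - q.1 := by field_simp
    have h2 : Real.exp (-(4 * Real.log n)) = ((n : ℝ) ^ 4)⁻¹ := by
      rw [Real.exp_neg, show (4 : ℝ) * Real.log n = (4 : ℕ) * Real.log n by norm_num,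
        Real.exp_nat_mul, Real.exp_log hn0]
    rw [h1, h2] at h
    exact h
  have hU : ∀ n, 1 ≤ n → P (⋃ q ∈ T n, E n q) ≤ ENNReal.ofReal (9 * ((n : ℝ) ^ 2)⁻¹) := by
    intro n hn
    have hn0 : (1 : ℝ) ≤ n := by exact_mod_cast hn
    rw [← ofReal_measureReal (measure_ne_top P _)]
    refine ENNReal.ofReal_le_ofReal ?_
    have hcard : ((T n).card : ℝ) ≤ ((n : ℝ) + 2) ^ 2 := by
      have := Finset.card_filter_le (Finset.range (n + 2) ×ˢ Finset.range (n + 2))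
        fun q : ℕ × ℕ => q.1 ≤ q.2
      rw [Finset.card_product, Finset.card_range] at this
      calc ((T n).card : ℝ) ≤ (((n + 2) * (n + 2) : ℕ) : ℝ) := by exact_mod_cast this
        _ = ((n : ℝ) + 2) ^ 2 := by push_cast; ring
    calc P.real (⋃ q ∈ T n, E n q) ≤ ∑ q ∈ T n, P.real (E n q) := measureReal_biUnion_finset_le _ _
      _ ≤ ∑ q ∈ T n, ((n : ℝ) ^ 4)⁻¹ := Finset.sum_le_sum (hE n hn)
      _ = (T n).card * ((n : ℝ) ^ 4)⁻¹ := by rw [Finset.sum_const, nsmul_eq_mul]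
      _ ≤ (3 * n) ^ 2 * ((n : ℝ) ^ 4)⁻¹ := by
          gcongr
          exact hcard.trans (by gcongr; linarith)
      _ = 9 * ((n : ℝ) ^ 2)⁻¹ := by field_simp; norm_num
  -- The index `n = 0` is excluded because the bound `9 * (n ^ 2)⁻¹` takes the value 0 there.
  have hsum : ∑' n, P (if 1 ≤ n then ⋃ q ∈ T n, E n q else ∅) ≠ ∞ := by
    have hs : Summable fun n : ℕ => 9 * ((n : ℝ) ^ 2)⁻¹ :=
      (Real.summable_nat_pow_inv.2 one_lt_two).mul_left 9
    refine ne_top_of_le_ne_top hs.tsum_ofReal_ne_top (ENNReal.tsum_le_tsum fun n => ?_)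
    split_ifs with hn
    · exact hU n hn
    · simp
  filter_upwards [ae_eventually_notMem hsum] with ω hω
  filter_upwards [hω, eventually_ge_atTop 1] with n hn hn1 i hi m hm him
  rw [if_pos hn1] at hn
  by_contra! hlt
  refine hn (Set.mem_biUnion (x := (i, m)) ?_ hlt.le)
  simp only [T, Finset.coe_filter, Set.mem_ofPred_eq, Finset.mem_product, Finset.mem_range]
  omega

theorem empDistFun_sub_eq (x : ℕ → ℝ) (n : ℕ) {a b : ℝ} (hab : a ≤ b) :
    empDistFun x n b - empDistFun x n a =
      (∑ j ∈ Finset.range n, (Set.Ioc a b).indicator (fun _ => (1 : ℝ)) (x j)) / n := by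
  rw [empDistFun, empDistFun, ← sub_div, ← Finset.sum_sub_distrib]
  congr 1
  refine Finset.sum_congr rfl fun j _ => ?_
  simp only [Set.indicator_apply, Set.mem_Ioc]
  split_ifs <;> grind

/-- Almost surely, eventually, the empirical increments are at most twice the true ones, up to an
error of order `log n / n`. -/
theorem ae_eventually_empDistFun_sub_le (hf : IsProbDensity f)
    (hX : ∀ i, HasLaw (X i) (volume.withDensity fun x => ENNReal.ofReal (f x)) P)
    (hindep : iIndepFun X P) :
    ∀ᵐ ω ∂P, ∀ᶠ n : ℕ in atTop, ∀ a b : ℝ,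
      |empDistFun (fun i => X i ω) n b - empDistFun (fun i => X i ω) n a| ≤
        2 * |distFun f b - distFun f a| + (4 + 4 * Real.log n) / n := by
  filter_upwards [ae_eventually_sum_indicator_le hf hX hindep] with ω hω
  filter_upwards [hω, eventually_ge_atTop 1] with n hn hn1 a b
  have hn0 : (0 : ℝ) < n := by exact_mod_cast hn1
  wlog hab : a ≤ b generalizing a b
  · rw [abs_sub_comm, abs_sub_comm (distFun f b)]
    exact this b a (le_of_not_ge hab)
  have hF := hf.monotone_distFun hab
  have hFa := hf.distFun_nonneg a
  have hFb := hf.distFun_le_one b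
  have ha0 : 0 ≤ n * distFun f a := by positivity
  have hb0 : 0 ≤ n * distFun f b := by have := hf.distFun_nonneg b; positivity
  -- Rounding outwards gives `m - i ≤ n * (F b - F a) + 2`, whence the constant 4. The `+ 1` keeps
  -- `F b` inside the half-open cell, and `m = n + 1` occurs when `F b = 1`.
  set i := ⌊n * distFun f a⌋₊ with hi
  set m := ⌊n * distFun f b⌋₊ + 1 with hm
  have hile : (i : ℝ) ≤ n * distFun f a := Nat.floor_le ha0
  have hilt : n * distFun f a < i + 1 := Nat.lt_floor_add_one _
  have hmle : (m : ℝ) ≤ n * distFun f b + 1 := by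
    rw [hm]; push_cast; linarith [Nat.floor_le hb0]
  have hmlt : n * distFun f b < m := by
    rw [hm]; push_cast; exact Nat.lt_floor_add_one _
  have him : i ≤ m := by
    have h : n * distFun f a ≤ n * distFun f b := by gcongr
    have : (i : ℝ) ≤ m := by linarith
    exact_mod_cast this
  have hmn : m ≤ n + 1 := by
    have h : n * distFun f b ≤ n * 1 := by gcongr
    have : (m : ℝ) ≤ ((n + 1 : ℕ) : ℝ) := by push_cast; linarith
    exact_mod_cast this
  have h := hn i (him.trans hmn) m hmn him
  have hsum : ∑ j ∈ Finset.range n, (Set.Ioc a b).indicator (fun _ => (1 : ℝ)) (X j ω) ≤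
      ∑ j ∈ Finset.range n, (distFun f ⁻¹' Set.Ico ((i : ℝ) / n) ((m : ℝ) / n)).indicator
        (fun _ => (1 : ℝ)) (X j ω) := by
    refine Finset.sum_le_sum fun j _ => ?_
    refine Set.indicator_le_indicator_of_subset (fun x hx => ?_) (fun _ => zero_le_one) _
    have h1 := hf.monotone_distFun hx.1.le
    have h2 := hf.monotone_distFun hx.2
    constructor
    · rw [div_le_iff₀ hn0]; nlinarith
    · rw [lt_div_iff₀ hn0]; nlinarith
  rw [empDistFun_sub_eq _ _ hab, abs_of_nonneg (sub_nonneg.2 hF), abs_of_nonneg, div_le_iff₀ hn0,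
    add_mul, div_mul_cancel₀ _ hn0.ne']
  · nlinarith
  · exact div_nonneg (Finset.sum_nonneg fun j _ => Set.indicator_nonneg (fun _ _ => zero_le_one) _)
      hn0.le

end Counting

end DiscrepancyPrinciple

namespace DiscrepancyPrinciple

/-! ### Bias of kernel smoothing -/

section Smoothing

variable {K : ℝ → ℝ}

theorem setIntegral_kernel_eq (x y : ℝ) {h : ℝ} (hh : 0 < h) :
    ∫ t in Set.Iic y, K ((t - x) / h) = h * ∫ u, K u * (if x ≤ y - h * u then 1 else 0) := by
  rw [← integral_indicator measurableSet_Iic]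
  have h1 : ∀ t, (Set.Iic y).indicator (fun t => K ((t - x) / h)) t =
      (fun v => K (v / h) * (if x ≤ y - v then 1 else 0)) (t - x) := by
    intro t
    simp only [Set.indicator_apply, Set.mem_Iic, mul_ite, mul_one, mul_zero]
    split_ifs <;> grind
  simp_rw [h1]
  rw [integral_sub_right_eq_self fun v => K (v / h) * (if x ≤ y - v then 1 else 0)]
  have h2 : ∀ v, K (v / h) * (if x ≤ y - v then 1 else 0) =
      (fun u => K u * (if x ≤ y - h * u then 1 else 0)) (v / h) := by
    intro v
    simp only [mul_div_cancel₀ v hh.ne']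
  simp_rw [h2]
  rw [Measure.integral_comp_div (fun u => K u * (if x ≤ y - h * u then 1 else 0)), abs_of_pos hh,
    smul_eq_mul]

theorem integrable_kernel_mul_ite (hK : Integrable K) (x y h : ℝ) :
    Integrable fun u => K u * (if x ≤ y - h * u then 1 else 0) := by
  have hS : MeasurableSet {u : ℝ | x ≤ y - h * u} :=
    measurableSet_le measurable_const (by fun_prop)
  refine (hK.indicator hS).congr (ae_of_all _ fun u => ?_)
  by_cases hu : x ≤ y - h * u <;> simp [hu]

/-- The smoothed empirical distribution function is an average of translates of the empirical
distribution function. -/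
theorem kernelDistFunEst_eq (hK : Integrable K) (x : ℕ → ℝ) (n : ℕ) {h : ℝ} (hh : 0 < h) (y : ℝ) :
    kernelDistFunEst K x n h y = ∫ u, K u * empDistFun x n (y - h * u) := by
  have hint : ∀ i, Integrable fun t => K ((t - x i) / h) := fun i =>
    (hK.comp_div hh.ne').comp_sub_right (x i)
  simp only [kernelDistFunEst, distFun, kernelDensityEst]
  rw [integral_const_mul, integral_finsetSum _ fun i _ => (hint i).integrableOn]
  simp_rw [setIntegral_kernel_eq _ y hh]
  rw [← Finset.mul_sum, ← integral_finsetSum _ fun i _ => integrable_kernel_mul_ite hK (x i) y h,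
    ← mul_assoc, ← integral_const_mul]
  refine integral_congr_ae (ae_of_all _ fun u => ?_)
  simp only [empDistFun]
  rw [← Finset.mul_sum]
  field_simp

theorem integrable_kernel_mul_empDistFun (hK : Integrable K) (x : ℕ → ℝ) (n : ℕ) (h y : ℝ) :
    Integrable fun u => K u * empDistFun x n (y - h * u) := by
  have := (integrable_finsetSum (Finset.range n)
    fun i _ => integrable_kernel_mul_ite hK (x i) y h).div_const (n : ℝ)
  refine this.congr (ae_of_all _ fun u => ?_)
  simp only [empDistFun]
  rw [← Finset.mul_sum, mul_div_assoc]

theorem IsKernelOfOrder.integrable_self {ℓ : ℕ} (hK : IsKernelOfOrder K ℓ) : Integrable K := by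
  simpa using hK.integrable 0 (Nat.zero_le _)

theorem IsKernelOfOrder.integrable_rpow_mul {ℓ : ℕ} (hℓ : 1 ≤ ℓ) (hK : IsKernelOfOrder K ℓ)
    {α : ℝ} (hα0 : 0 ≤ α) (hα1 : α ≤ 1) : Integrable fun u => |u| ^ α * |K u| := by
  have h1 : Integrable fun u => u * K u := by simpa using hK.integrable 1 hℓ
  refine (hK.integrable_self.abs.add h1.abs).mono' ?_ (ae_of_all _ fun u => ?_)
  · exact (measurable_id.abs.pow_const α).aestronglyMeasurable.mul
      hK.integrable_self.abs.aestronglyMeasurable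
  -- Integrability of the zeroth and first moments suffices; this is where `1 ≤ ℓ` enters.
  · have hu : |u| ^ α ≤ 1 + |u| := by
      rcases le_total |u| 1 with h | h
      · exact (Real.rpow_le_one (abs_nonneg u) h hα0).trans (by simp)
      · calc |u| ^ α ≤ |u| ^ (1 : ℝ) := Real.rpow_le_rpow_of_exponent_le h hα1
          _ ≤ 1 + |u| := by rw [Real.rpow_one]; linarith
    rw [Real.norm_eq_abs, abs_of_nonneg (by positivity), Pi.add_apply, abs_mul]
    nlinarith [abs_nonneg (K u)]

/-- A bound on the bias of smoothing in terms of a modulus of continuity of the empirical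
distribution function. -/
theorem abs_empDistFun_sub_kernelDistFunEst_le {ℓ : ℕ} (hℓ : 1 ≤ ℓ) (hK : IsKernelOfOrder K ℓ)
    {α : ℝ} (hα0 : 0 ≤ α) (hα1 : α ≤ 1) {x : ℕ → ℝ} {n : ℕ} {A ε : ℝ}
    (hx : ∀ a b, |empDistFun x n b - empDistFun x n a| ≤ A * |b - a| ^ α + ε)
    {h : ℝ} (hh : 0 < h) (y : ℝ) :
    |empDistFun x n y - kernelDistFunEst K x n h y| ≤
      A * (∫ u, |u| ^ α * |K u|) * h ^ α + ε * ∫ u, |K u| := by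
  have hKi := hK.integrable_self
  have hKα := hK.integrable_rpow_mul hℓ hα0 hα1
  -- As `K` has integral one, the constant `F_n y` is its own average against `K`.
  have h1 : empDistFun x n y - kernelDistFunEst K x n h y =
      ∫ u, (empDistFun x n y - empDistFun x n (y - h * u)) * K u := by
    have : ∀ u, (empDistFun x n y - empDistFun x n (y - h * u)) * K u =
        empDistFun x n y * K u - K u * empDistFun x n (y - h * u) := fun u => by ring
    simp_rw [this]
    rw [integral_sub (hKi.const_mul _) (integrable_kernel_mul_empDistFun hKi x n h y),
      integral_const_mul, hK.integral_eq_one, mul_one, kernelDistFunEst_eq hKi x n hh]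
  rw [h1, ← Real.norm_eq_abs]
  calc ‖∫ u, (empDistFun x n y - empDistFun x n (y - h * u)) * K u‖
      ≤ ∫ u, (A * h ^ α * (|u| ^ α * |K u|) + ε * |K u|) := by
        refine norm_integral_le_of_norm_le ((hKα.const_mul _).add (hKi.abs.const_mul _))
          (ae_of_all _ fun u => ?_)
        have h2 := hx (y - h * u) y
        rw [sub_sub_cancel, abs_mul, abs_of_pos hh, Real.mul_rpow hh.le (abs_nonneg u)] at h2
        rw [norm_mul, Real.norm_eq_abs, Real.norm_eq_abs]
        calc _ ≤ (A * (h ^ α * |u| ^ α) + ε) * |K u| := by gcongr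
          _ = _ := by ring
    _ = _ := by
        rw [integral_add (hKα.const_mul _) (hKi.abs.const_mul _), integral_const_mul,
          integral_const_mul]
        ring

end Smoothing

/-! ### Comparison with the uniform distance -/

section Distances

theorem kolmogorovDist_le {F G : ℝ → ℝ} {D : ℝ} (h : ∀ y, |F y - G y| ≤ D) :
    kolmogorovDist F G ≤ D :=
  ciSup_le h

theorem kuiperDist_le (k : ℕ) {F G : ℝ → ℝ} {D : ℝ} (h : ∀ y, |F y - G y| ≤ D) :
    kuiperDist k F G ≤ 2 * k * D := by
  have hD : 0 ≤ D := (abs_nonneg _).trans (h 0)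
  refine Real.iSup_le (fun p => ?_) (by positivity)
  calc ∑ i, |(F (p.1.2 i) - F (p.1.1 i)) - (G (p.1.2 i) - G (p.1.1 i))|
      ≤ ∑ _i : Fin k, 2 * D := by
        refine Finset.sum_le_sum fun i _ => ?_
        have h1 := abs_le.1 (h (p.1.2 i))
        have h2 := abs_le.1 (h (p.1.1 i))
        exact abs_le.2 ⟨by linarith, by linarith⟩
    _ = 2 * k * D := by simp; ring

/-- The only property of `d` needed; each of the `k` Kuiper increments costs two pointwise errors.
-/
theorem exists_dist_le_mul {d : (ℝ → ℝ) → (ℝ → ℝ) → ℝ}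
    (hd : d = kolmogorovDist ∨ ∃ k : ℕ, 1 ≤ k ∧ d = kuiperDist k) :
    ∃ c : ℝ, 0 < c ∧ ∀ (F G : ℝ → ℝ) (D : ℝ), (∀ y, |F y - G y| ≤ D) → d F G ≤ c * D := by
  rcases hd with rfl | ⟨k, hk, rfl⟩
  · exact ⟨1, one_pos, fun F G D h => by simpa using kolmogorovDist_le h⟩
  · exact ⟨2 * k, by positivity, fun F G D h => kuiperDist_le k h⟩

end Distances

/-! ### Asymptotic comparisons -/

section Rates

theorem isLittleO_log_div :
    (fun n : ℕ => (4 + 4 * Real.log n) / n) =o[atTop]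
      fun n : ℕ => Real.sqrt (Real.log (Real.log n) / n) := by
  have h1 : (fun x : ℝ => 4 + 4 * Real.log x) =o[atTop] fun x : ℝ => x ^ (1 / 2 : ℝ) := by
    refine IsLittleO.add ?_ ((isLittleO_log_rpow_atTop (by norm_num)).const_mul_left 4)
    exact isLittleO_const_left.2 (Or.inr
      (tendsto_norm_atTop_atTop.comp (tendsto_rpow_atTop (by norm_num))))
  have h2 : (fun n : ℕ => (4 + 4 * Real.log n) / n) =o[atTop]
      fun n : ℕ => (n : ℝ) ^ (1 / 2 : ℝ) * (n : ℝ)⁻¹ := by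
    simp_rw [div_eq_mul_inv]
    exact (h1.comp_tendsto tendsto_natCast_atTop_atTop).mul_isBigO (isBigO_refl _ _)
  -- It remains to compare `n ^ (-1/2)` with the target, which dominates it once `log (log n) ≥ 1`.
  refine h2.trans_isBigO (IsBigO.of_bound 1 ?_)
  have hll : Tendsto (fun n : ℕ => Real.log (Real.log n)) atTop atTop :=
    Real.tendsto_log_atTop.comp (Real.tendsto_log_atTop.comp tendsto_natCast_atTop_atTop)
  filter_upwards [hll.eventually_ge_atTop 1, eventually_ge_atTop 1] with n hn hn1
  have hn0 : (0 : ℝ) < n := by exact_mod_cast hn1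
  rw [one_mul, Real.norm_of_nonneg (by positivity), Real.norm_of_nonneg (by positivity),
    ← Real.sqrt_eq_rpow]
  refine Real.le_sqrt_of_sq_le ?_
  rw [mul_pow, Real.sq_sqrt hn0.le]
  calc (n : ℝ) * (n : ℝ)⁻¹ ^ 2 = 1 / n := by field_simp
    _ ≤ Real.log (Real.log n) / n := by gcongr

theorem tendsto_mul_atTop_of_le_rpow {α : ℝ} (hα : 0 < α) {s h : ℕ → ℝ} {c : ℝ} (hc : 0 < c)
    (hsα : Tendsto (fun n : ℕ => (n : ℝ) ^ α * s n) atTop atTop)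
    (hsh : ∀ᶠ n in atTop, 0 < h n ∧ s n ≤ c * h n ^ α) :
    Tendsto (fun n : ℕ => (n : ℝ) * h n) atTop atTop := by
  have h1 : Tendsto (fun n : ℕ => ((n : ℝ) * h n) ^ α) atTop atTop := by
    refine tendsto_atTop_mono' _ ?_ (hsα.const_mul_atTop (inv_pos.2 hc))
    filter_upwards [hsh] with n hn
    rw [Real.mul_rpow (Nat.cast_nonneg n) hn.1.le, inv_mul_le_iff₀ hc]
    calc (n : ℝ) ^ α * s n ≤ (n : ℝ) ^ α * (c * h n ^ α) := by gcongr; exact hn.2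
      _ = _ := by ring
  refine ((tendsto_rpow_atTop (inv_pos.2 hα)).comp h1).congr' ?_
  filter_upwards [hsh] with n hn
  exact Real.rpow_rpow_inv (mul_nonneg (Nat.cast_nonneg n) hn.1.le) hα.ne'

end Rates

end DiscrepancyPrinciple

/-! ### Conclusion for discrepancy bandwidths -/

namespace DiscrepancyPrinciple

/-- If the empirical increments are controlled by a Hölder modulus up to an error negligible with
respect to the threshold, then the threshold is at most of the order of a power of the bandwidth. -/
theorem tendsto_mul_bandwidth {K : ℝ → ℝ} {ℓ : ℕ} (hℓ : 1 ≤ ℓ) (hK : IsKernelOfOrder K ℓ)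
    {d : (ℝ → ℝ) → (ℝ → ℝ) → ℝ}
    (hd : d = kolmogorovDist ∨ ∃ k : ℕ, 1 ≤ k ∧ d = kuiperDist k)
    {α : ℝ} (hα0 : 0 < α) (hα1 : α ≤ 1) {s ε : ℕ → ℝ} (hε : ε =o[atTop] s)
    (hsα : Tendsto (fun n : ℕ => (n : ℝ) ^ α * s n) atTop atTop) {x : ℕ → ℝ} {A : ℝ} (hA : 0 ≤ A)
    (hx : ∀ᶠ n in atTop, ∀ a b, |empDistFun x n b - empDistFun x n a| ≤ A * |b - a| ^ α + ε n)
    {h : ℕ → ℝ} (hh : ∀ᶠ n in atTop, IsDiscrepancyBandwidth d s K x n (h n)) :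
    Tendsto (fun n : ℕ => (n : ℝ) * h n) atTop atTop := by
  obtain ⟨c, hc, hdc⟩ := exists_dist_le_mul hd
  have hI : 0 ≤ ∫ u, |u| ^ α * |K u| := integral_nonneg fun u => by positivity
  have hJ : 0 ≤ ∫ u, |K u| := integral_nonneg fun u => abs_nonneg _
  set I := ∫ u, |u| ^ α * |K u|
  set J := ∫ u, |K u|
  refine tendsto_mul_atTop_of_le_rpow hα0 (c := 2 * (c * (A * I)) + 1) (by positivity) hsα ?_
  -- The constant makes `c * J * ‖ε n‖ ≤ s n / 2`, which is absorbed on the left and leaves `s n ≤ 2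
  -- * c * A * I * h n ^ α`. Each `+ 1` only ensures positivity.
  filter_upwards [hx, hh, hsα.eventually_gt_atTop 0,
    hε.bound (c := (2 * (c * J + 1))⁻¹) (by positivity)] with n hxn hhn hsn hεn
  have hs0 : 0 < s n := pos_of_mul_pos_right hsn (by positivity)
  have hhα : 0 < h n ^ α := Real.rpow_pos_of_pos hhn.1 _
  refine ⟨hhn.1, ?_⟩
  have h1 := hdc _ _ _
    (abs_empDistFun_sub_kernelDistFunEst_le hℓ hK hα0.le hα1 hxn hhn.1)
  rw [hhn.2] at h1
  rw [Real.norm_of_nonneg hs0.le, inv_mul_eq_div, le_div_iff₀ (by positivity)] at hεn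
  have h2 : ε n ≤ ‖ε n‖ := Real.le_norm_self _
  have h3 : c * (ε n * J) ≤ ‖ε n‖ * (c * J) := by
    calc c * (ε n * J) = ε n * (c * J) := by ring
      _ ≤ ‖ε n‖ * (c * J) := by gcongr
  have h4 : 0 ≤ ‖ε n‖ := norm_nonneg _
  change s n ≤ c * (A * I * h n ^ α + ε n * J) at h1
  nlinarith

end DiscrepancyPrinciple

theorem mainTheorem2 {Ω : Type*} [MeasurableSpace Ω] (P : Measure Ω) [IsProbabilityMeasure P]
    (X : ℕ → Ω → ℝ) (f : ℝ → ℝ) (hf : DiscrepancyPrinciple.IsProbDensity f)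
    (hX : ∀ i, HasLaw (X i) (volume.withDensity fun x => ENNReal.ofReal (f x)) P)
    (hindep : iIndepFun X P)
    (K : ℝ → ℝ) (ℓ : ℕ) (hℓ : 1 ≤ ℓ) (hK : DiscrepancyPrinciple.IsKernelOfOrder K ℓ)
    (d : (ℝ → ℝ) → (ℝ → ℝ) → ℝ)
    (hd : d = DiscrepancyPrinciple.kolmogorovDist ∨
      ∃ k : ℕ, 1 ≤ k ∧ d = DiscrepancyPrinciple.kuiperDist k)
    (α : ℝ≥0) (hα0 : 0 < α) (hα1 : α ≤ 1)
    (hF : ∃ C : ℝ≥0, HolderWith C α (DiscrepancyPrinciple.distFun f))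
    (s : ℕ → ℝ)
    (hs : (fun n : ℕ => Real.sqrt (Real.log (Real.log n) / n)) =o[atTop] s)
    (hsα : Tendsto (fun n : ℕ => (n : ℝ) ^ (α : ℝ) * s n) atTop atTop) :
    ∀ᵐ ω ∂P, ∀ h : ℕ → ℝ,
      (∀ᶠ n in atTop,
        DiscrepancyPrinciple.IsDiscrepancyBandwidth d s K (fun i => X i ω) n (h n)) →
      Tendsto (fun n : ℕ => (n : ℝ) * h n) atTop atTop := by
  obtain ⟨C, hC⟩ := hF
  filter_upwards [DiscrepancyPrinciple.ae_eventually_empDistFun_sub_le hf hX hindep] with ω hω h hh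
  refine DiscrepancyPrinciple.tendsto_mul_bandwidth hℓ hK hd (NNReal.coe_pos.2 hα0)
    (by exact_mod_cast hα1) (DiscrepancyPrinciple.isLittleO_log_div.trans hs) hsα
    (A := 2 * C) (by positivity) ?_ hh
  filter_upwards [hω] with n hn a b
  refine (hn a b).trans ?_
  have := hC.dist_le b a
  rw [Real.dist_eq, Real.dist_eq] at this
  linarith
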